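/- Let $D\subset\mathbb C^n$ be a domain (a non-empty connected open set) and let $U$ be an open neighborhood of a local holomorphic peak point $p_0\in\partial D$; that is, there are an open neighborhood $V$ of $p_0$ and a function $\varphi$, holomorphic on $D\cap V$ and continuous on $\overline D\cap V$, with $\varphi(p_0)=1$ and $|\varphi|<1$ on $(\overline D\cap V)\setminus\{p_0\}$. If $$\lim_{D\cap U\ni z\to p_0}h^k_{D\cap U}(z)=1,\quad\text{then}\quad \lim_{D\ni z\to p_0}h^k_{D}(z)=1 .$$ Here, for an open set $G\subset\mathbb C^n$ (not necessarily connected) and $z\in G$, $$h^k_G(z)=\sup\{\tanh r:\ r>0,\ B^k_G(z,r)\subset f(\mathbb B_n)\text{ for some injective holomorphic } f:\mathbb B_n\to G\},$$ with $\sup\emptyset=0$, where $\mathbb B_n$ is the open Euclidean unit ball of $\mathbb C^n$, $B^k_G(z,r)=\{w\in G: k_G(z,w)<r\}$, and the Kobayashi pseudodistance $k_G$ is the largest $[0,\infty]$-valued pseudodistance on $G$ that does not exceed the Lempert function $$l_G(z,w)=\inf\{\tanh^{-1}|\lambda|:\ |\lambda|<1,\ f:\Delta\to G\text{ holomorphic},\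 f(0)=z,\ f(\lambda)=w\}\qquad(\inf\emptyset=\infty),$$ $\Delta$ being the open unit disc of $\mathbb C$. -/

import Mathlib

open Set Filter Topology
open scoped ENNReal

noncomputable section

/-- `ℂⁿ` with its Euclidean norm. -/
abbrev CSpace (n : ℕ) : Type := EuclideanSpace ℂ (Fin n)

/-- `f` is a holomorphic map from the open set `A` into the set `B`, that is `f ∈ 𝒪(A, B)`. -/
def HolMap {E F : Type*} [NormedAddCommGroup E] [NormedSpace ℂ E]
    [NormedAddCommGroup F] [NormedSpace ℂ F] (A : Set E) (B : Set F) (f : E → F) : Prop :=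
  DifferentiableOn ℂ f A ∧ MapsTo f A B

/-- The Lempert function
`l_D(z,w) = inf {artanh |μ| : f ∈ 𝒪(Δ, D), f(0) = z, f(μ) = w, μ ∈ Δ}`,
with values in `[0,∞]`; it is `∞` if no analytic disc in `D` passes through both points. -/
def lempert {n : ℕ} (D : Set (CSpace n)) (z w : CSpace n) : ℝ≥0∞ :=
  sInf {t | ∃ (f : ℂ → CSpace n) (μ : ℂ), HolMap (Metric.ball 0 1) D f ∧ ‖μ‖ < 1 ∧
    f 0 = z ∧ f μ = w ∧ t = ENNReal.ofReal (Real.artanh ‖μ‖)}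

/-- `d` restricts to a `[0,∞]`-valued pseudodistance on `D`. -/
structure IsPseudodistOn {n : ℕ} (D : Set (CSpace n)) (d : CSpace n → CSpace n → ℝ≥0∞) :
    Prop where
  self : ∀ z ∈ D, d z z = 0
  symm : ∀ z ∈ D, ∀ w ∈ D, d z w = d w z
  triangle : ∀ x ∈ D, ∀ y ∈ D, ∀ z ∈ D, d x z ≤ d x y + d y z

/-- The Kobayashi pseudodistance `k_D`: the largest pseudodistance on `D` that does not exceed the
Lempert function. The open set `D` need not be connected; the value `∞` is taken exactly when the two
points lie in different components. -/
def kobayashi {n : ℕ} (D : Set (CSpace n)) (z w : CSpace n) : ℝ≥0∞ :=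
  ⨆ d ∈ {d : CSpace n → CSpace n → ℝ≥0∞ |
    IsPseudodistOn D d ∧ ∀ x ∈ D, ∀ y ∈ D, d x y ≤ lempert D x y}, d z w

/-- The supremum defining `kobayashi` is itself a pseudodistance not exceeding the Lempert function,
hence the largest one. -/
theorem kobayashi_isPseudodistOn {n : ℕ} (D : Set (CSpace n)) :
    IsPseudodistOn D (kobayashi D) ∧
      ∀ x ∈ D, ∀ y ∈ D, kobayashi D x y ≤ lempert D x y := by
  refine ⟨⟨?_, ?_, ?_⟩, ?_⟩
  · intro z hz
    refine le_antisymm (iSup₂_le fun d hd => (hd.1.self z hz).le) bot_le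
  · intro z hz w hw
    exact iSup_congr fun d => iSup_congr fun hd => hd.1.symm z hz w hw
  · intro x hx y hy z hz
    refine iSup₂_le fun d hd => (hd.1.triangle x hx y hy z hz).trans (add_le_add ?_ ?_)
    · exact le_iSup₂ (f := fun (d : CSpace n → CSpace n → ℝ≥0∞) (_ : d ∈ _) => d x y) d hd
    · exact le_iSup₂ (f := fun (d : CSpace n → CSpace n → ℝ≥0∞) (_ : d ∈ _) => d y z) d hd
  · intro x hx y hy
    exact iSup₂_le fun d hd => hd.2 x hx y hy

/-- The Kobayashi ball `B^k_D(z, r)`. -/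
def kobayashiBall {n : ℕ} (D : Set (CSpace n)) (z : CSpace n) (r : ℝ) : Set (CSpace n) :=
  {w ∈ D | kobayashi D z w < ENNReal.ofReal r}

/-- The Fridman invariant
`h^k_D(z) = sup {tanh r : r > 0, B^k_D(z, r) ⊆ f(𝔹ₙ), f ∈ 𝒪(𝔹ₙ, D), f injective}`.
It is `0` if no `r > 0` is admissible (`sSup ∅ = 0`); the set is bounded above by `1`. -/
def fridman {n : ℕ} (D : Set (CSpace n)) (z : CSpace n) : ℝ :=
  sSup {t | ∃ (r : ℝ) (f : CSpace n → CSpace n), 0 < r ∧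
    HolMap (Metric.ball 0 1) D f ∧ InjOn f (Metric.ball 0 1) ∧
    kobayashiBall D z r ⊆ f '' Metric.ball 0 1 ∧ t = Real.tanh r}

/-- `p` is a local holomorphic peak point of `D`: there are an open neighborhood `V` of `p` and a
function `φ`, holomorphic on `D ∩ V` and continuous on `closure D ∩ V`, with `φ p = 1` and
`|φ| < 1` on `closure D ∩ V` outside `p`. -/
def IsLocalHolPeakPoint {n : ℕ} (D : Set (CSpace n)) (p : CSpace n) : Prop :=
  p ∈ frontier D ∧ ∃ (V : Set (CSpace n)) (φ : CSpace n → ℂ), IsOpen V ∧ p ∈ V ∧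
    DifferentiableOn ℂ φ (D ∩ V) ∧ ContinuousOn φ (closure D ∩ V) ∧
    φ p = 1 ∧ ∀ z ∈ closure D ∩ V, z ≠ p → ‖φ z‖ < 1

end

/-!
The theorem follows from a localization of Kobayashi balls (`kobayashiBall_localization`): for a small
ball `B` around the peak point `p` and a constant `C`, every `R > 0` satisfies
`B^k_D(z, R) ⊆ B^k_{D ∩ B}(z, C R)` once `z ∈ D` is close to `p`. Indeed, if the Fridman invariant of
`D ∩ U` tends to `1`, then near `p` the ball `B^k_{D ∩ U}(z, C R)` is contained in the image of an
injective holomorphic map of the unit ball into `D ∩ U`, hence so is `B^k_D(z, R)`, and `R` is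
arbitrary.

The domain need not be bounded or hyperbolic, so the main point is that analytic discs in `D` centred
near `p` map a disc of a fixed radius `r` into `B` (`disc_localization`). This is proved with a
plurisubharmonic function on `D` which is bounded above, has a logarithmic pole at the centre of the
disc, and is bounded below off a small neighbourhood of the pole. Such a function is constructed from
the peak function, and its composition with the disc is subject to a Schwarz lemma. Subharmonicity is
used only in the form that `log E` is touched from below at every point by `log ‖h‖` with `h`
holomorphic (`HasHolMinorantAt`), so that the maximum principle reduces to that for holomorphic maps.

Consequently short pieces of discs in `D` which start near `p` lie in `D ∩ B`, and their length grows
at most by the factor `C` on passing from `D` to `D ∩ B`. The Schwarz–Pick lemma, applied to the peak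
function, shows that points of `D ∩ B` which are not near `p` are far from `z` for the Kobayashi
pseudodistance of `D ∩ B`. Hence that pseudodistance, truncated at `C R`, extends by the constant
`C R` to a function on `D` which is `C`-Lipschitz along short pieces of discs, hence along all discs
(`increment_le_of_small`), hence for the Kobayashi pseudodistance of `D`
(`ofReal_abs_sub_le_kobayashi`).
-/

/-! ### Discs in a domain and functions Lipschitz for the Kobayashi pseudodistance -/

lemma tanh_add_eq (s t : ℝ) :
    Real.tanh (s + t) = (Real.tanh s + Real.tanh t) / (1 + Real.tanh s * Real.tanh t) := by
  have hs := (Real.cosh_pos s).ne'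
  have ht := (Real.cosh_pos t).ne'
  have h := (Real.cosh_pos (s + t)).ne'
  rw [Real.cosh_add] at h
  simp only [Real.tanh_eq_sinh_div_cosh, Real.sinh_add, Real.cosh_add]
  have e : 1 + Real.sinh s / Real.cosh s * (Real.sinh t / Real.cosh t) =
      (Real.cosh s * Real.cosh t + Real.sinh s * Real.sinh t) / (Real.cosh s * Real.cosh t) := by
    field_simp
  rw [e]
  field_simp

lemma tanh_strictMono : StrictMono Real.tanh := by
  intro s t hst
  by_contra h
  have := Real.artanh_le_artanh (Real.neg_one_lt_tanh t) (Real.tanh_lt_one s) (not_lt.1 h)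
  rw [Real.artanh_tanh, Real.artanh_tanh] at this
  exact absurd hst (not_lt.2 this)

/-- The automorphism of the unit disc which sends `0` to `a`. -/
noncomputable def discAut (a ζ : ℂ) : ℂ := (ζ + a) / (1 + (starRingEnd ℂ) a * ζ)

lemma discAut_zero (a : ℂ) : discAut a 0 = a := by simp [discAut]

lemma discAut_neg_self (a : ℂ) : discAut a (-a) = 0 := by simp [discAut]

lemma one_add_conj_mul_ne_zero {a ζ : ℂ} (ha : ‖a‖ < 1) (hζ : ‖ζ‖ < 1) :
    1 + (starRingEnd ℂ) a * ζ ≠ 0 := by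
  intro h
  have h1 : (starRingEnd ℂ) a * ζ = -1 := by linear_combination h
  have h2 : ‖a‖ * ‖ζ‖ = 1 := by
    have := congrArg norm h1
    simpa using this
  nlinarith [norm_nonneg a, norm_nonneg ζ]

lemma norm_sq_sub_norm_sq_discAut (a ζ : ℂ) :
    ‖1 + (starRingEnd ℂ) a * ζ‖ ^ 2 - ‖ζ + a‖ ^ 2 = (1 - ‖a‖ ^ 2) * (1 - ‖ζ‖ ^ 2) := by
  simp only [Complex.sq_norm, Complex.normSq_apply, Complex.add_re, Complex.add_im, Complex.mul_re,
    Complex.mul_im, Complex.conj_re, Complex.conj_im, Complex.one_re, Complex.one_im]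
  ring

lemma norm_discAut_le {a ζ : ℂ} (ha : ‖a‖ < 1) (hζ : ‖ζ‖ < 1) :
    ‖discAut a ζ‖ ≤ (‖a‖ + ‖ζ‖) / (1 + ‖a‖ * ‖ζ‖) := by
  have hN : 0 < ‖1 + (starRingEnd ℂ) a * ζ‖ := norm_pos_iff.2 (one_add_conj_mul_ne_zero ha hζ)
  have hN2 : ‖1 + (starRingEnd ℂ) a * ζ‖ ≤ 1 + ‖a‖ * ‖ζ‖ := by
    refine (norm_add_le _ _).trans ?_
    simp
  have key := norm_sq_sub_norm_sq_discAut a ζ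
  have hc : 0 ≤ (1 - ‖a‖ ^ 2) * (1 - ‖ζ‖ ^ 2) := by
    apply mul_nonneg <;> nlinarith [norm_nonneg a, norm_nonneg ζ]
  have hd : 0 < 1 + ‖a‖ * ‖ζ‖ := by positivity
  rw [discAut, norm_div, div_le_div_iff₀ hN hd]
  refine abs_le_of_sq_le_sq' ?_ (by positivity) |>.2
  have e : ‖ζ + a‖ ^ 2 = ‖1 + (starRingEnd ℂ) a * ζ‖ ^ 2 - (1 - ‖a‖ ^ 2) * (1 - ‖ζ‖ ^ 2) := by
    linarith
  have hsq : ‖1 + (starRingEnd ℂ) a * ζ‖ ^ 2 ≤ (1 + ‖a‖ * ‖ζ‖) ^ 2 := by gcongr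
  rw [mul_pow, mul_pow, e]
  nlinarith [mul_le_mul_of_nonneg_left hsq hc]

lemma norm_discAut_lt_one {a ζ : ℂ} (ha : ‖a‖ < 1) (hζ : ‖ζ‖ < 1) : ‖discAut a ζ‖ < 1 := by
  refine (norm_discAut_le ha hζ).trans_lt ?_
  rw [div_lt_one (by positivity)]
  nlinarith

lemma differentiableOn_discAut {a : ℂ} (ha : ‖a‖ < 1) :
    DifferentiableOn ℂ (discAut a) (Metric.ball 0 1) := by
  intro ζ hζ
  have h := one_add_conj_mul_ne_zero ha (mem_ball_zero_iff.1 hζ)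
  unfold discAut
  exact DifferentiableAt.differentiableWithinAt (by fun_prop (disch := exact h))

lemma mapsTo_discAut {a : ℂ} (ha : ‖a‖ < 1) :
    MapsTo (discAut a) (Metric.ball 0 1) (Metric.ball 0 1) := fun _ hζ =>
  mem_ball_zero_iff.2 (norm_discAut_lt_one ha (mem_ball_zero_iff.1 hζ))

lemma HolMap.comp_discAut {F : Type*} [NormedAddCommGroup F] [NormedSpace ℂ F] {B : Set F}
    {f : ℂ → F} (hf : HolMap (Metric.ball 0 1) B f) {a : ℂ} (ha : ‖a‖ < 1) :
    HolMap (Metric.ball 0 1) B (f ∘ discAut a) :=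
  ⟨hf.1.comp (differentiableOn_discAut ha) (mapsTo_discAut ha), hf.2.comp (mapsTo_discAut ha)⟩

/-- The points `f 0` and `f μ` of an analytic disc can be exchanged: `f` precomposed with an
involution of the unit disc. -/
lemma HolMap.exists_swap {F : Type*} [NormedAddCommGroup F] [NormedSpace ℂ F] {B : Set F}
    {f : ℂ → F} (hf : HolMap (Metric.ball 0 1) B f) {μ : ℂ} (hμ : ‖μ‖ < 1) :
    ∃ g : ℂ → F, HolMap (Metric.ball 0 1) B g ∧ g 0 = f μ ∧ g μ = f 0 := by
  refine ⟨fun ζ => f (discAut μ (-ζ)), ⟨(hf.comp_discAut hμ).1.comp (differentiableOn_neg _) ?_, ?_⟩,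
    by simp [discAut_zero], by simp [discAut_neg_self]⟩
  · intro ζ hζ; simpa using hζ
  · intro ζ hζ; exact (hf.comp_discAut hμ).2 (x := -ζ) (by simpa using hζ)

lemma artanh_add_of_mem {x y : ℝ} (hx : x ∈ Ioo (-1) 1) (hy : y ∈ Ioo (-1) 1) :
    Real.artanh ((x + y) / (1 + x * y)) = Real.artanh x + Real.artanh y := by
  rw [← Real.artanh_tanh (Real.artanh x + Real.artanh y), tanh_add_eq, Real.tanh_artanh hx,
    Real.tanh_artanh hy]

/-- Consequence of the Schwarz–Pick lemma: the hyperbolic distance to `0` grows by at most the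
hyperbolic distance of the arguments. -/
lemma artanh_norm_le_of_holMap {g : ℂ → ℂ} (hg : HolMap (Metric.ball 0 1) (Metric.ball 0 1) g)
    {μ : ℂ} (hμ : ‖μ‖ < 1) :
    Real.artanh ‖g μ‖ ≤ Real.artanh ‖g 0‖ + Real.artanh ‖μ‖ := by
  have h0 : ‖g 0‖ < 1 := mem_ball_zero_iff.1 (hg.2 (Metric.mem_ball_self one_pos))
  have h1 : ‖g μ‖ < 1 := mem_ball_zero_iff.1 (hg.2 (mem_ball_zero_iff.2 hμ))
  have h0' : ‖-g 0‖ < 1 := by rwa [norm_neg]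
  set c := discAut (-g 0) (g μ) with hc
  have hcμ : ‖c‖ ≤ ‖μ‖ := by
    refine Complex.norm_le_norm_of_mapsTo_ball (f := discAut (-g 0) ∘ g) (R := 1)
      ((differentiableOn_discAut h0').comp hg.1 hg.2)
      (((mapsTo_discAut h0').comp hg.2).mono_right Metric.ball_subset_closedBall) ?_ hμ
    simp [discAut]
  have hgc : g μ = discAut (g 0) c := by
    have e1 : 1 - (starRingEnd ℂ) (g 0) * g μ ≠ 0 := by
      simpa [sub_eq_add_neg] using one_add_conj_mul_ne_zero h0' h1
    have e2 : 1 - (starRingEnd ℂ) (g 0) * g 0 ≠ 0 := by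
      simpa [sub_eq_add_neg] using one_add_conj_mul_ne_zero h0' h0
    have hc' : c = (g μ - g 0) / (1 - (starRingEnd ℂ) (g 0) * g μ) := by
      simp [hc, discAut, sub_eq_add_neg]
    have e3 : 1 + (starRingEnd ℂ) (g 0) * c =
        (1 - (starRingEnd ℂ) (g 0) * g 0) / (1 - (starRingEnd ℂ) (g 0) * g μ) := by
      rw [hc']; field_simp; ring
    rw [discAut, e3, hc', div_add' _ _ _ e1, div_div_div_cancel_right₀ e1, eq_div_iff e2]
    ring
  have hc1 : ‖c‖ < 1 := hcμ.trans_lt hμ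
  have hn := norm_nonneg c
  have hn0 := norm_nonneg (g 0)
  calc Real.artanh ‖g μ‖ ≤ Real.artanh ((‖g 0‖ + ‖c‖) / (1 + ‖g 0‖ * ‖c‖)) := by
        refine Real.artanh_le_artanh (by linarith [norm_nonneg (g μ)]) ?_ ?_
        · rw [div_lt_one (by positivity)]; nlinarith
        · rw [hgc]; exact norm_discAut_le h0 hc1
    _ = Real.artanh ‖g 0‖ + Real.artanh ‖c‖ :=
        artanh_add_of_mem ⟨by linarith, h0⟩ ⟨by linarith, hc1⟩
    _ ≤ _ := by
        gcongr
        exact Real.artanh_le_artanh (by linarith) hμ hcμ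

/-- A bound on the increments of `ρ` along short pieces of analytic discs holds along all of them,
as a hyperbolic segment can be cut into short pieces of equal length. -/
lemma increment_le_of_small {n : ℕ} {D : Set (CSpace n)} {ρ : CSpace n → ℝ} {C b : ℝ}
    (hb : 0 < b)
    (h : ∀ f : ℂ → CSpace n, HolMap (Metric.ball 0 1) D f → ∀ ν : ℂ, ‖ν‖ < 1 → ‖ν‖ < b →
      ρ (f ν) ≤ ρ (f 0) + C * Real.artanh ‖ν‖)
    {f : ℂ → CSpace n} (hf : HolMap (Metric.ball 0 1) D f) {μ : ℂ} (hμ : ‖μ‖ < 1) :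
    ρ (f μ) ≤ ρ (f 0) + C * Real.artanh ‖μ‖ := by
  rcases eq_or_ne μ 0 with rfl | hμ0
  · simp
  set e : ℂ := μ / ‖μ‖ with he
  have hne : (‖μ‖ : ℂ) ≠ 0 := by simpa using hμ0
  have hen : ‖e‖ = 1 := by simp [he, norm_ne_zero_iff.2 hμ0]
  have hee : (starRingEnd ℂ) e * e = 1 := by
    rw [Complex.conj_mul', hen]; simp
  set s := Real.artanh ‖μ‖ with hs
  have hs0 : 0 ≤ s := Real.artanh_nonneg (norm_nonneg μ)
  have hnorm : ∀ t : ℝ, 0 ≤ t → ‖(Real.tanh t : ℂ) * e‖ = Real.tanh t := by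
    intro t ht
    rw [norm_mul, hen, mul_one, Complex.norm_real, Real.norm_eq_abs, abs_of_nonneg]
    simpa using tanh_strictMono.monotone ht
  obtain ⟨N, hN0, hN⟩ : ∃ N : ℕ, 0 < N ∧ Real.tanh (s / N) < b := by
    have hcont : Tendsto (fun x : ℝ => Real.tanh x) (𝓝 0) (𝓝 0) := by
      have : Continuous Real.tanh := by
        have e : Real.tanh = fun x => Real.sinh x / Real.cosh x := by
          ext x; exact Real.tanh_eq_sinh_div_cosh x
        rw [e]
        exact Real.continuous_sinh.div Real.continuous_cosh fun x => (Real.cosh_pos x).ne'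
      simpa using this.tendsto 0
    have ht := hcont.comp (tendsto_const_div_atTop_nhds_zero_nat s)
    obtain ⟨N, h1, h2⟩ := ((ht.eventually (gt_mem_nhds hb)).and (eventually_gt_atTop 0)).exists
    exact ⟨N, h2, h1⟩
  have hsN : 0 ≤ s / N := by positivity
  have step : ∀ k : ℕ, ρ (f ((Real.tanh (k * (s / N)) : ℂ) * e)) ≤
      ρ (f 0) + C * (k * (s / N)) := by
    intro k
    induction k with
    | zero => simp
    | succ k ih =>
      have hk : 0 ≤ k * (s / N) := by positivity
      have ha : ‖(Real.tanh (k * (s / N)) : ℂ) * e‖ < 1 := by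
        rw [hnorm _ hk]; exact Real.tanh_lt_one _
      have hstep := h _ (hf.comp_discAut ha) ((Real.tanh (s / N) : ℂ) * e)
        (by rw [hnorm _ hsN]; exact Real.tanh_lt_one _) (by rwa [hnorm _ hsN])
      rw [hnorm _ hsN, Real.artanh_tanh, Function.comp_apply, Function.comp_apply, discAut_zero]
        at hstep
      have hpt : discAut ((Real.tanh (k * (s / N)) : ℂ) * e) ((Real.tanh (s / N) : ℂ) * e) =
          (Real.tanh ((k + 1 : ℕ) * (s / N)) : ℂ) * e := by
        have e1 : ((k + 1 : ℕ) : ℝ) * (s / N) = s / N + k * (s / N) := by push_cast; ring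
        rw [e1, tanh_add_eq, discAut]
        have e2 : (starRingEnd ℂ) ((Real.tanh (k * (s / N)) : ℂ) * e) *
            ((Real.tanh (s / N) : ℂ) * e) =
            (Real.tanh (s / N) : ℂ) * (Real.tanh (k * (s / N)) : ℂ) := by
          rw [map_mul, Complex.conj_ofReal]
          linear_combination (Real.tanh (s / N) : ℂ) * (Real.tanh (k * (s / N)) : ℂ) * hee
        rw [e2, Complex.ofReal_div, Complex.ofReal_add, Complex.ofReal_add, Complex.ofReal_mul,
          Complex.ofReal_one]
        ring
      rw [hpt] at hstep
      push_cast at hstep ih ⊢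
      linarith
  have hfin := step N
  have hNs : (N : ℝ) * (s / N) = s := by field_simp
  have hμe : (Real.tanh s : ℂ) * e = μ := by
    rw [hs, Real.tanh_artanh ⟨by linarith [norm_nonneg μ], hμ⟩, he]
    field_simp
  rwa [hNs, hμe] at hfin

/-- A function which increases at most at the rate `C` along analytic discs in `D` is
`C`-Lipschitz for the Kobayashi pseudodistance of `D`. -/
lemma ofReal_abs_sub_le_kobayashi {n : ℕ} {D : Set (CSpace n)} {ρ : CSpace n → ℝ} {C : ℝ}
    (hC : 0 < C)
    (h : ∀ f : ℂ → CSpace n, HolMap (Metric.ball 0 1) D f → ∀ μ : ℂ, ‖μ‖ < 1 →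
      ρ (f μ) ≤ ρ (f 0) + C * Real.artanh ‖μ‖) (z w : CSpace n) :
    ENNReal.ofReal (|ρ z - ρ w| / C) ≤ kobayashi D z w := by
  refine le_iSup₂ (f := fun (d : CSpace n → CSpace n → ℝ≥0∞) (_ : d ∈ _) => d z w)
    (fun z w => ENNReal.ofReal (|ρ z - ρ w| / C)) ⟨⟨?_, ?_, ?_⟩, ?_⟩
  · intro x _; simp
  · intro x _ y _; rw [abs_sub_comm]
  · intro x _ y _ w _
    rw [← ENNReal.ofReal_add (by positivity) (by positivity), ← add_div]
    gcongr
    exact abs_sub_le _ _ _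
  · intro x _ y _
    refine le_sInf ?_
    rintro t ⟨f, μ, hf, hμ, rfl, rfl, rfl⟩
    refine ENNReal.ofReal_le_ofReal ?_
    rw [div_le_iff₀ hC, abs_le]
    obtain ⟨g, hg, hg0, hgμ⟩ := hf.exists_swap hμ
    have h1 := h f hf μ hμ
    have h2 := h g hg μ hμ
    rw [hg0, hgμ] at h2
    constructor <;> linarith

lemma lempert_anti {n : ℕ} {A B : Set (CSpace n)} (hAB : A ⊆ B) (z w : CSpace n) :
    lempert B z w ≤ lempert A z w := by
  refine sInf_le_sInf ?_
  rintro t ⟨f, μ, hf, h⟩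
  exact ⟨f, μ, ⟨hf.1, hf.2.mono_right hAB⟩, h⟩

lemma kobayashi_anti {n : ℕ} {A B : Set (CSpace n)} (hAB : A ⊆ B) (z w : CSpace n) :
    kobayashi B z w ≤ kobayashi A z w := by
  refine iSup₂_le fun d hd => ?_
  refine le_iSup₂ (f := fun (d : CSpace n → CSpace n → ℝ≥0∞) (_ : d ∈ _) => d z w) d
    ⟨⟨?_, ?_, ?_⟩, ?_⟩
  · exact fun x hx => hd.1.self x (hAB hx)
  · exact fun x hx y hy => hd.1.symm x (hAB hx) y (hAB hy)
  · exact fun x hx y hy w hw => hd.1.triangle x (hAB hx) y (hAB hy) w (hAB hw)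
  · exact fun x hx y hy => (hd.2 x (hAB hx) y (hAB hy)).trans (lempert_anti hAB x y)

/-! ### A maximum principle for functions with holomorphic minorants -/

/-- Near `c` the function `E` dominates the norm of a holomorphic map, with equality at `c`. This is
how the subharmonicity of `log E` at `c` is expressed; the map may take values in any complex normed
space, so that norms of vector valued maps are covered. -/
def HasHolMinorantAt (E : ℂ → ℝ) (c : ℂ) : Prop :=
  ∃ (F : Type) (_ : NormedAddCommGroup F) (_ : NormedSpace ℂ F) (h : ℂ → F),
    (∀ᶠ ζ in 𝓝 c, DifferentiableAt ℂ h ζ) ∧ (∀ᶠ ζ in 𝓝 c, ‖h ζ‖ ≤ E ζ) ∧ ‖h c‖ = E c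

lemma HasHolMinorantAt.eventually_eq {E : ℂ → ℝ} {c : ℂ} (hE : HasHolMinorantAt E c)
    (hmax : IsLocalMax E c) : ∀ᶠ ζ in 𝓝 c, E ζ = E c := by
  obtain ⟨F, _, _, h, hd, hle, heq⟩ := hE
  have hloc : IsLocalMax (norm ∘ h) c := by
    filter_upwards [hle, hmax] with ζ h1 h2
    simpa [heq] using h1.trans h2
  filter_upwards [Complex.norm_eventually_eq_of_isLocalMax hd hloc, hle, hmax] with ζ h1 h2 h3
  exact le_antisymm h3 (by rw [← heq, ← h1]; exact h2)

lemma le_of_hasHolMinorantAt {E : ℂ → ℝ} {R M : ℝ}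
    (hc : ContinuousOn E (Metric.closedBall 0 R))
    (hE : ∀ c ∈ Metric.ball (0 : ℂ) R, HasHolMinorantAt E c)
    (hM : ∀ ζ : ℂ, ‖ζ‖ = R → E ζ ≤ M) {ζ : ℂ} (hζ : ζ ∈ Metric.closedBall (0 : ℂ) R) :
    E ζ ≤ M := by
  have hK : IsCompact (Metric.closedBall (0 : ℂ) R) := isCompact_closedBall _ _
  obtain ⟨a, ha, hamax⟩ := hK.exists_isMaxOn ⟨ζ, hζ⟩ hc
  -- Among the maximum points take one of largest modulus.
  have hS : IsCompact (Metric.closedBall (0 : ℂ) R ∩ E ⁻¹' {E a}) :=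
    hK.of_isClosed_subset
      (hc.preimage_isClosed_of_isClosed Metric.isClosed_closedBall isClosed_singleton)
      inter_subset_left
  obtain ⟨c, ⟨hcR, hcE⟩, hcmax⟩ := hS.exists_isMaxOn ⟨a, ha, rfl⟩ continuous_norm.continuousOn
  have hcE : E c = E a := hcE
  refine (hamax hζ).trans (hcE ▸ ?_)
  have hcR' : ‖c‖ ≤ R := mem_closedBall_zero_iff.1 hcR
  rcases hcR'.eq_or_lt with h | hlt
  · exact hM c h
  exfalso
  have hball : ∀ᶠ ξ in 𝓝 c, ξ ∈ Metric.ball (0 : ℂ) R :=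
    Metric.isOpen_ball.mem_nhds (mem_ball_zero_iff.2 hlt)
  have hlm : IsLocalMax E c := by
    filter_upwards [hball] with ξ hξ
    rw [hcE]
    exact hamax (Metric.ball_subset_closedBall hξ)
  obtain ⟨u, hu, hcu⟩ : ∃ u : ℂ, ‖u‖ = 1 ∧ c = (‖c‖ : ℂ) * u := by
    rcases eq_or_ne c 0 with rfl | h0
    · exact ⟨1, by simp⟩
    · have : (‖c‖ : ℂ) ≠ 0 := by simpa using h0
      exact ⟨c / ‖c‖, by simp [h0], by field_simp⟩
  have ht : Tendsto (fun t : ℝ => (t : ℂ) * u) (𝓝 ‖c‖) (𝓝 c) := by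
    have : Continuous fun t : ℝ => (t : ℂ) * u := by fun_prop
    simpa [← hcu] using this.tendsto ‖c‖
  have hev := ht.mono_left (nhdsWithin_le_nhds (s := Ioi ‖c‖)) |>.eventually
    (((hE c (mem_ball_zero_iff.2 hlt)).eventually_eq hlm).and hball)
  obtain ⟨t, ⟨h1, h2⟩, h3⟩ := (hev.and self_mem_nhdsWithin).exists
  have hle : ‖(t : ℂ) * u‖ ≤ ‖c‖ :=
    hcmax ⟨Metric.ball_subset_closedBall h2, by simp [h1, hcE]⟩
  rw [norm_mul, hu, mul_one, Complex.norm_real, Real.norm_eq_abs] at hle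
  exact absurd ((le_abs_self t).trans hle) (not_le.2 h3)

/-- A Schwarz lemma: if in addition `E` is the norm of a holomorphic map near `0` which vanishes
there, then a bound for `E` improves to a linear bound. -/
lemma le_mul_norm_of_hasHolMinorantAt {F : Type} [NormedAddCommGroup F] [NormedSpace ℂ F]
    [CompleteSpace F] {E : ℂ → ℝ} {R M : ℝ} (hR : 0 < R)
    (hc : ContinuousOn E (Metric.closedBall 0 R))
    (hE : ∀ c ∈ Metric.ball (0 : ℂ) R, HasHolMinorantAt E c)
    (hM : ∀ ζ : ℂ, ‖ζ‖ = R → E ζ ≤ M) {h : ℂ → F} (hd : ∀ᶠ ζ in 𝓝 0, DifferentiableAt ℂ h ζ)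
    (h0 : h 0 = 0) (hEh : ∀ᶠ ζ in 𝓝 0, E ζ = ‖h ζ‖) {ζ : ℂ}
    (hζ : ζ ∈ Metric.closedBall (0 : ℂ) R) :
    E ζ ≤ M / R * ‖ζ‖ := by
  classical
  have hE0 : E 0 = 0 := by simpa [h0] using hEh.self_of_nhds
  set Q : ℂ → ℝ := Function.update (fun ζ => E ζ / ‖ζ‖) 0 ‖deriv h 0‖ with hQ
  have hQne : ∀ ξ : ℂ, ξ ≠ 0 → Q ξ = E ξ / ‖ξ‖ := fun ξ hξ => Function.update_of_ne hξ _ _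
  have hQev : ∀ c : ℂ, c ≠ 0 → Q =ᶠ[𝓝 c] fun ζ => E ζ / ‖ζ‖ := fun c hc0 => by
    filter_upwards [isOpen_ne.mem_nhds hc0] with ξ hξ using hQne ξ hξ
  have hQ0 : Q =ᶠ[𝓝 0] fun ζ => ‖dslope h 0 ζ‖ := by
    filter_upwards [hEh] with ξ hξ
    rcases eq_or_ne ξ 0 with rfl | hne
    · simp [hQ]
    · rw [hQne ξ hne, dslope_of_ne _ hne, slope_def_module, hξ, h0]
      simp [norm_smul, div_eq_inv_mul]
  obtain ⟨s, hs, hsd⟩ := hd.exists_mem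
  have hdslope : DifferentiableOn ℂ (dslope h 0) s :=
    (Complex.differentiableOn_dslope hs).2 fun ξ hξ => (hsd ξ hξ).differentiableWithinAt
  have hdsl : ∀ᶠ ξ in 𝓝 (0 : ℂ), DifferentiableAt ℂ (dslope h 0) ξ := by
    filter_upwards [eventually_mem_nhds_iff.2 hs] with ξ hξ using hdslope.differentiableAt hξ
  have key : Q ζ ≤ M / R := by
    refine le_of_hasHolMinorantAt ?_ ?_ ?_ hζ
    · intro c hcR
      rcases eq_or_ne c 0 with rfl | hc0
      · exact (hdsl.self_of_nhds.continuousAt.norm.congr hQ0.symm).continuousWithinAt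
      · have h1 : ContinuousWithinAt (fun ζ => E ζ / ‖ζ‖) (Metric.closedBall 0 R) c :=
          (hc c hcR).div continuous_norm.continuousWithinAt (norm_ne_zero_iff.2 hc0)
        exact h1.congr_of_eventuallyEq (nhdsWithin_le_nhds (hQev c hc0)) (hQne c hc0)
    · intro c hcR
      rcases eq_or_ne c 0 with rfl | hc0
      · exact ⟨F, inferInstance, inferInstance, dslope h 0, hdsl, hQ0.mono fun ξ hξ => hξ.ge,
          hQ0.self_of_nhds.symm⟩
      · obtain ⟨G, iG, iG2, g, hgd, hgle, hgeq⟩ := hE c hcR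
        refine ⟨G, iG, iG2, fun ζ => ζ⁻¹ • g ζ, ?_, ?_, ?_⟩
        · filter_upwards [hgd, isOpen_ne.mem_nhds hc0] with ξ h1 h2
          exact (differentiableAt_inv h2).smul h1
        · filter_upwards [hgle, hQev c hc0] with ξ h1 h2
          rw [h2, norm_smul, norm_inv, div_eq_inv_mul]
          gcongr
        · rw [hQne c hc0, norm_smul, norm_inv, div_eq_inv_mul, hgeq]
    · intro ξ hξ
      have : ξ ≠ 0 := by rw [← norm_pos_iff, hξ]; exact hR
      rw [hQne ξ this, hξ]
      gcongr
      exact hM ξ hξ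
  rcases eq_or_ne ζ 0 with rfl | hne
  · simp [hE0]
  · rwa [hQne ζ hne, div_le_iff₀ (norm_pos_iff.2 hne)] at key

/-! ### Localization of analytic discs at a peak point -/

lemma exists_norm_le_of_peak {n : ℕ} {D V : Set (CSpace n)} {p : CSpace n} {φ : CSpace n → ℂ}
    {ε δ : ℝ} (hδ : 0 < δ) (hεV : Metric.closedBall p ε ⊆ V)
    (hφc : ContinuousOn φ (closure D ∩ V))
    (hφ1 : ∀ z ∈ closure D ∩ V, z ≠ p → ‖φ z‖ < 1) :
    ∃ s : ℝ, 0 < s ∧ s < 1 ∧ ∀ z ∈ D, dist z p ≤ ε → δ ≤ dist z p → ‖φ z‖ ≤ s := by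
  set K := closure D ∩ Metric.closedBall p ε ∩ {z | δ ≤ dist z p} with hK
  have hKc : IsCompact K :=
    ((isCompact_closedBall p ε).inter_left isClosed_closure).inter_right
      (isClosed_le continuous_const (by fun_prop))
  have hKV : K ⊆ closure D ∩ V := fun z hz => ⟨hz.1.1, hεV hz.1.2⟩
  rcases K.eq_empty_or_nonempty with h0 | hne
  · refine ⟨1 / 2, by norm_num, by norm_num, fun z hz h1 h2 => ?_⟩
    have : z ∈ K := ⟨⟨subset_closure hz, h1⟩, h2⟩
    simp [h0] at this
  · obtain ⟨x, hx, hxmax⟩ := hKc.exists_isMaxOn hne (hφc.mono hKV).norm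
    have hxp : x ≠ p := by
      rintro rfl
      have := hx.2
      simp only [mem_ofPred_eq, dist_self] at this
      linarith
    refine ⟨max (1 / 2) ‖φ x‖, by positivity, max_lt (by norm_num) (hφ1 x (hKV hx) hxp),
      fun z hz h1 h2 => ?_⟩
    exact (hxmax ⟨⟨subset_closure hz, h1⟩, h2⟩).trans (le_max_right _ _)

lemma eventually_lt_norm_of_peak {n : ℕ} {D V : Set (CSpace n)} {p : CSpace n}
    {φ : CSpace n → ℂ} (hV : IsOpen V) (hpV : p ∈ V) (hp : p ∈ closure D)
    (hφc : ContinuousOn φ (closure D ∩ V)) (hφp : φ p = 1) {a : ℝ} (ha : a < 1) :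
    ∀ᶠ z in 𝓝[D] p, a < ‖φ z‖ := by
  have h1 : ContinuousWithinAt φ (closure D ∩ V) p := hφc p ⟨hp, hpV⟩
  have h2 : 𝓝[D] p ≤ 𝓝[closure D ∩ V] p := by
    rw [nhdsWithin_inter_of_mem' (nhdsWithin_le_nhds (hV.mem_nhds hpV))]
    exact nhdsWithin_mono _ subset_closure
  have h3 : Tendsto (fun z => ‖φ z‖) (𝓝[D] p) (𝓝 1) := by
    simpa [hφp] using (h1.tendsto.mono_left h2).norm
  exact h3.eventually (lt_mem_nhds ha)

/-- The holomorphic function `x ↦ exp (κ (2⟪y, x⟫ - |y|²))`, whose modulus for `κ ≥ 0` is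
at most `exp (κ |x|²)`, with equality at `y`. -/
noncomputable def gaussMinorant {n : ℕ} (κ : ℝ) (y x : CSpace n) : ℂ :=
  Complex.exp (κ * (2 * inner ℂ y x - (‖y‖ ^ 2 : ℝ)))

lemma norm_gaussMinorant {n : ℕ} (κ : ℝ) (y x : CSpace n) :
    ‖gaussMinorant κ y x‖ = Real.exp (κ * (‖x‖ ^ 2 - ‖x - y‖ ^ 2)) := by
  rw [gaussMinorant, Complex.norm_exp]
  congr 1
  have h := inner_re_symm (𝕜 := ℂ) x y
  rw [@norm_sub_sq ℂ, h, Complex.re_ofReal_mul, Complex.sub_re, Complex.ofReal_re,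
    Complex.mul_re, Complex.re_ofNat, Complex.im_ofNat]
  simp only [RCLike.re_to_complex]
  ring

lemma differentiable_gaussMinorant {n : ℕ} (κ : ℝ) (y : CSpace n) :
    Differentiable ℂ (gaussMinorant κ y) := by
  have h : Differentiable ℂ fun x : CSpace n => inner ℂ y x := (innerSL ℂ y).differentiable
  unfold gaussMinorant
  fun_prop

/-- The function `t exp ((1 - t²) / 2)` on `[0, 1]`, continued by `1`. Its logarithm is
`log t - t² / 2 + 1 / 2`, truncated at its maximum `0`. -/
noncomputable def poleFactor (t : ℝ) : ℝ := min t 1 * Real.exp ((1 - min t 1 ^ 2) / 2)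

lemma continuous_poleFactor : Continuous poleFactor := by
  unfold poleFactor
  fun_prop

lemma poleFactor_of_le {t : ℝ} (ht : t ≤ 1) : poleFactor t = t * Real.exp ((1 - t ^ 2) / 2) := by
  rw [poleFactor, min_eq_left ht]

lemma poleFactor_of_ge {t : ℝ} (ht : 1 ≤ t) : poleFactor t = 1 := by
  simp [poleFactor, min_eq_right ht]

lemma mul_exp_le_one (t : ℝ) : t * Real.exp ((1 - t ^ 2) / 2) ≤ 1 := by
  have h1 : t ≤ Real.exp ((t ^ 2 - 1) / 2) := by
    nlinarith [Real.add_one_le_exp ((t ^ 2 - 1) / 2), sq_nonneg (t - 1)]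
  calc t * Real.exp ((1 - t ^ 2) / 2)
      ≤ Real.exp ((t ^ 2 - 1) / 2) * Real.exp ((1 - t ^ 2) / 2) := by gcongr
    _ = 1 := by rw [← Real.exp_add]; ring_nf; exact Real.exp_zero

lemma mul_exp_le_poleFactor (t : ℝ) : t * Real.exp ((1 - t ^ 2) / 2) ≤ poleFactor t := by
  rcases le_total t 1 with h | h
  · exact (poleFactor_of_le h).ge
  · exact (mul_exp_le_one t).trans (poleFactor_of_ge h).ge

lemma poleFactor_le_one (t : ℝ) : poleFactor t ≤ 1 := by
  rcases le_total t 1 with h | h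
  · exact (poleFactor_of_le h).trans_le (mul_exp_le_one t)
  · exact (poleFactor_of_ge h).le

/-- All analytic discs in `D` whose centre is close to the peak point `p` map a disc of fixed radius
into a given ball around `p`.

For a disc `f` with centre `z = f 0` the Schwarz lemma is applied to `E ∘ f`, where `log E` is a
plurisubharmonic function on `D`, bounded above, with a logarithmic pole at `z`, and bounded below off
a small ball around `z`. It is built from `log |φ|`: a multiple of it, made strictly plurisubharmonic
by the addition of a multiple of `|w - p|²`, is small at distance `≥ ε / 2` from `p` and can be
glued there to a constant; the strictness then pays for the truncated pole. -/
lemma disc_localization {n : ℕ} {D V : Set (CSpace n)} {p : CSpace n} {φ : CSpace n → ℂ} {ε : ℝ}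
    (hD : IsOpen D) (hV : IsOpen V) (hp : p ∈ closure D) (hε : 0 < ε)
    (hεV : Metric.closedBall p ε ⊆ V)
    (hφd : DifferentiableOn ℂ φ (D ∩ V)) (hφc : ContinuousOn φ (closure D ∩ V)) (hφp : φ p = 1)
    (hφ1 : ∀ z ∈ closure D ∩ V, z ≠ p → ‖φ z‖ < 1) :
    ∃ ρ r : ℝ, 0 < ρ ∧ 0 < r ∧ r ≤ 1 ∧ ∀ f : ℂ → CSpace n,
      HolMap (Metric.ball 0 1) D f → f 0 ∈ Metric.ball p ρ →
      MapsTo f (Metric.ball 0 r) (Metric.ball p ε) := by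
  have hpV : p ∈ V := hεV (Metric.mem_closedBall_self hε.le)
  obtain ⟨s, hs0, hs1, hs⟩ := exists_norm_le_of_peak (half_pos hε) hεV hφc hφ1
  -- `|φ|` is at most `σ ^ 2` far from `p` and at least `σ` near `p`, which leaves room for gluing.
  set σ := √s with hσ
  have hσ0 : 0 < σ := Real.sqrt_pos.2 hs0
  have hσ1 : σ < 1 := by rw [hσ, Real.sqrt_lt' one_pos]; simpa
  have hσs : σ ^ 2 = s := Real.sq_sqrt hs0.le
  obtain ⟨η, hη, hηφ⟩ := Metric.mem_nhdsWithin_iff.1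
    (eventually_lt_norm_of_peak hV hpV hp hφc hφp hσ1)
  obtain ⟨ρ, hρ, hρη, hρε⟩ : ∃ ρ, 0 < ρ ∧ 2 * ρ ≤ η ∧ 4 * ρ ≤ ε :=
    ⟨min (η / 2) (ε / 4), by positivity, by linarith [min_le_left (η / 2) (ε / 4)],
      by linarith [min_le_right (η / 2) (ε / 4)]⟩
  have hinner : ∀ w ∈ D, dist w p < 2 * ρ → σ ≤ ‖φ w‖ := fun w hw hwp =>
    le_of_lt (hηφ ⟨Metric.mem_ball.2 (hwp.trans_le hρη), hw⟩)
  -- With this `κ` the term `κ |w - p|²` compensates the term `-|w - z|² / (2ρ²)` of the pole factor.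
  set κ : ℝ := 1 / (2 * ρ ^ 2) with hκ
  have hκ0 : 0 < κ := by positivity
  set M : ℝ := Real.exp (κ * ε ^ 2) with hM
  have hM0 : 0 < M := Real.exp_pos _
  have hM1 : 1 ≤ M := Real.one_le_exp (by positivity)
  obtain ⟨m, hm⟩ : ∃ m : ℕ, σ ^ m * M ≤ 1 := by
    have h1 := (tendsto_pow_atTop_nhds_zero_of_lt_one hσ0.le hσ1).mul_const M
    rw [zero_mul] at h1
    exact (h1.eventually (ge_mem_nhds one_pos)).exists
  set c : ℝ := σ ^ m with hc
  have hc0 : 0 < c := by positivity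
  have hc1 : c ≤ 1 := pow_le_one₀ hσ0.le hσ1.le
  -- The logarithm of `Φ` is strictly plurisubharmonic; `Φ` is at most `c` far from `p`.
  set Φ : CSpace n → ℝ := fun w => ‖φ w‖ ^ m * Real.exp (κ * ‖w - p‖ ^ 2) with hΦ
  have hΦfar : ∀ w ∈ D, dist w p ≤ ε → ε / 2 ≤ dist w p → Φ w ≤ c := by
    intro w hw h1 h2
    calc Φ w ≤ (σ ^ 2) ^ m * M := by
          simp only [hΦ, hM]
          rw [dist_eq_norm] at h1
          gcongr
          rw [hσs]
          exact hs w hw (by rwa [dist_eq_norm]) h2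
      _ = c * (σ ^ m * M) := by rw [hc]; ring
      _ ≤ c := mul_le_of_le_one_right hc0.le hm
  have hΦnear : ∀ w ∈ D, dist w p < 2 * ρ → c ≤ Φ w := by
    intro w hw h1
    calc c = c * 1 := (mul_one c).symm
      _ ≤ _ := by
        simp only [hΦ, hc]
        gcongr
        · exact hinner w hw h1
        · exact Real.one_le_exp (by positivity)
  have hΦM : ∀ w ∈ D, dist w p ≤ ε → Φ w ≤ M := by
    intro w hw h1
    have h2 : ‖φ w‖ ≤ 1 := by
      rcases eq_or_ne w p with rfl | hne
      · simp [hφp]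
      · exact (hφ1 w ⟨subset_closure hw, hεV h1⟩ hne).le
    calc Φ w ≤ 1 ^ m * M := by
          simp only [hΦ, hM]
          rw [dist_eq_norm] at h1
          gcongr
      _ = M := by simp
  set Ψ : CSpace n → ℝ := fun w => if dist w p < ε then max (Φ w) c else c with hΨ
  have hΨin : ∀ w, dist w p < ε → Ψ w = max (Φ w) c := fun w hw => if_pos hw
  have hΨout : ∀ w ∈ D, ε / 2 ≤ dist w p → Ψ w = c := by
    intro w hw h
    by_cases h1 : dist w p < ε
    · rw [hΨin w h1, max_eq_right (hΦfar w hw h1.le h)]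
    · exact if_neg h1
  have hΨc : ∀ w, c ≤ Ψ w := by
    intro w
    simp only [hΨ]
    split_ifs
    · exact le_max_right _ _
    · exact le_rfl
  have hΨM : ∀ w ∈ D, Ψ w ≤ M := by
    intro w hw
    simp only [hΨ]
    split_ifs with h
    · exact max_le (hΦM w hw h.le) (hc1.trans hM1)
    · exact hc1.trans hM1
  refine ⟨ρ, c / (2 * M), hρ, by positivity, ?_, fun f hf hfz => ?_⟩
  · rw [div_le_one (by positivity)]; linarith
  set z := f 0 with hz
  have hzp : dist z p < ρ := hfz
  -- The function `E` with the pole at `z`.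
  set E : CSpace n → ℝ := fun w => poleFactor (dist w z / ρ) * Ψ w with hE
  have hfD : ∀ ζ : ℂ, ‖ζ‖ < 1 → f ζ ∈ D := fun ζ hζ => hf.2 (mem_ball_zero_iff.2 hζ)
  have hdiff : ∀ ζ : ℂ, ‖ζ‖ < 1 → DifferentiableAt ℂ f ζ := fun ζ hζ =>
    hf.1.differentiableAt (Metric.isOpen_ball.mem_nhds (mem_ball_zero_iff.2 hζ))
  have hcont : ∀ ζ : ℂ, ‖ζ‖ < 1 → ContinuousAt f ζ := fun ζ hζ => (hdiff ζ hζ).continuousAt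
  have hφf : ∀ ζ : ℂ, ‖ζ‖ < 1 → dist (f ζ) p < ε → DifferentiableAt ℂ (fun ζ => φ (f ζ)) ζ :=
    fun ζ hζ h => DifferentiableAt.comp ζ (hφd.differentiableAt
      ((hD.inter hV).mem_nhds ⟨hfD ζ hζ, hεV (Metric.mem_closedBall.2 h.le)⟩)) (hdiff ζ hζ)
  have hnorm : ∀ ζ : ℂ, ‖ζ‖ < 1 → ∀ᶠ ξ in 𝓝 ζ, ‖ξ‖ < 1 := fun ζ hζ =>
    (continuous_norm.tendsto ζ).eventually (gt_mem_nhds hζ)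
  have hdist : ∀ ζ : ℂ, ‖ζ‖ < 1 → ∀ a : CSpace n, ContinuousAt (fun ξ => dist (f ξ) a) ζ :=
    fun ζ hζ a => (hcont ζ hζ).dist continuousAt_const
  have hΨcont : ∀ ζ : ℂ, ‖ζ‖ < 1 → ContinuousAt (fun ξ => Ψ (f ξ)) ζ := by
    intro ζ hζ
    rcases lt_or_ge (dist (f ζ) p) ε with h | h
    · have h1 : ContinuousAt (fun ξ => max (Φ (f ξ)) c) ζ := by
        have h2 := (hφf ζ hζ h).continuousAt
        have h3 := hcont ζ hζ
        simp only [hΦ]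
        exact ((h2.norm.pow m).mul (((h3.sub_const p).norm.pow 2).const_mul κ).rexp).sup
          continuousAt_const
      refine h1.congr ?_
      filter_upwards [(hdist ζ hζ p).eventually (gt_mem_nhds h)] with ξ hξ
      exact (hΨin _ hξ).symm
    · refine (continuousAt_const (y := c)).congr ?_
      filter_upwards [hnorm ζ hζ, (hdist ζ hζ p).eventually
        (lt_mem_nhds (show ε / 2 < dist (f ζ) p by linarith))] with ξ h1 h2
      exact (hΨout _ (hfD ξ h1) h2.le).symm
  have hEcont : ContinuousOn (fun ξ => E (f ξ)) (Metric.closedBall 0 (1 / 2)) := by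
    intro ζ hζ
    have hζ1 : ‖ζ‖ < 1 := (mem_closedBall_zero_iff.1 hζ).trans_lt (by norm_num)
    exact ((continuous_poleFactor.continuousAt.comp ((hdist ζ hζ1 z).div_const ρ)).mul
      (hΨcont ζ hζ1)).continuousWithinAt
  -- Near `z` the function `E` is the norm of the holomorphic map `H`.
  set H : CSpace n → CSpace n := fun w =>
    ((ρ⁻¹ * Real.exp (1 / 2) : ℝ) * φ w ^ m * gaussMinorant κ (z - p) (w - p)) • (w - z) with hH
  have hHnorm : ∀ w, ‖H w‖ =
      dist w z / ρ * Real.exp ((1 - (dist w z / ρ) ^ 2) / 2) * Φ w := by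
    intro w
    have e1 : Real.exp (κ * (‖w - p‖ ^ 2 - ‖w - z‖ ^ 2)) * Real.exp (1 / 2) =
        Real.exp ((1 - (‖w - z‖ / ρ) ^ 2) / 2) * Real.exp (κ * ‖w - p‖ ^ 2) := by
      rw [← Real.exp_add, ← Real.exp_add, hκ]
      congr 1
      field_simp
      ring
    simp only [hH, hΦ]
    rw [norm_smul, norm_mul, norm_mul, norm_gaussMinorant, norm_pow, Complex.norm_real,
      Real.norm_of_nonneg (by positivity), sub_sub_sub_cancel_right, dist_eq_norm]
    linear_combination (ρ⁻¹ * ‖φ w‖ ^ m * ‖w - z‖) * e1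
  have hHE : ∀ w, dist w p < ε → ‖H w‖ ≤ E w := by
    intro w hw
    rw [hHnorm]
    simp only [hE]
    rw [hΨin w hw]
    have h1 := mul_exp_le_poleFactor (dist w z / ρ)
    have h2 : 0 ≤ Φ w := by simp only [hΦ]; positivity
    have h3 : 0 ≤ dist w z / ρ * Real.exp ((1 - (dist w z / ρ) ^ 2) / 2) := by positivity
    exact mul_le_mul h1 (le_max_left _ _) h2 (h3.trans h1)
  have htri : ∀ w, dist w z ≤ ρ → dist w p < 2 * ρ := fun w hw => by
    linarith [dist_triangle w z p]
  have hHeq : ∀ w ∈ D, dist w z ≤ ρ → ‖H w‖ = E w := by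
    intro w hw hwz
    have h1 := htri w hwz
    rw [hHnorm]
    simp only [hE]
    rw [hΨin w (by linarith), max_eq_left (hΦnear w hw h1),
      poleFactor_of_le ((div_le_one hρ).2 hwz)]
  have hHdiff : ∀ ζ : ℂ, ‖ζ‖ < 1 → dist (f ζ) p < ε →
      DifferentiableAt ℂ (fun ζ => H (f ζ)) ζ := by
    intro ζ hζ h
    have h1 := hφf ζ hζ h
    have h2 := hdiff ζ hζ
    have h3 : DifferentiableAt ℂ (fun ζ => gaussMinorant κ (z - p) (f ζ - p)) ζ :=
      (differentiable_gaussMinorant κ (z - p) _).comp ζ (h2.sub_const p)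
    simp only [hH]
    exact (((h1.pow m).const_mul _).mul h3).smul (h2.sub_const z)
  have hmin : ∀ ζ ∈ Metric.ball (0 : ℂ) (1 / 2), HasHolMinorantAt (fun ξ => E (f ξ)) ζ := by
    intro ζ hζ
    have hζ1 : ‖ζ‖ < 1 := (mem_ball_zero_iff.1 hζ).trans (by norm_num)
    have hnearε : dist (f ζ) p < ε → ∀ᶠ ξ in 𝓝 ζ, ‖ξ‖ < 1 ∧ dist (f ξ) p < ε := fun h =>
      (hnorm ζ hζ1).and ((hdist ζ hζ1 p).eventually (gt_mem_nhds h))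
    -- On the sphere `dist (f ζ) z = ρ` as well, `H` is a minorant, as `t exp ((1 - t²) / 2) ≤ 1`.
    rcases le_or_gt (dist (f ζ) z) ρ with hle | hgt
    · have h1 := hnearε (by linarith [htri _ hle])
      exact ⟨CSpace n, inferInstance, inferInstance, fun ξ => H (f ξ),
        h1.mono fun ξ hξ => hHdiff ξ hξ.1 hξ.2,
        h1.mono fun ξ hξ => hHE _ hξ.2, hHeq _ (hfD ζ hζ1) hle⟩
    have hEΨ : ∀ᶠ ξ in 𝓝 ζ, E (f ξ) = Ψ (f ξ) := by
      filter_upwards [(hdist ζ hζ1 z).eventually (lt_mem_nhds hgt)] with ξ hξ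
      simp only [hE]
      rw [poleFactor_of_ge ((one_le_div hρ).2 hξ.le), one_mul]
    by_cases hcase : dist (f ζ) p < ε ∧ c ≤ Φ (f ζ)
    · obtain ⟨hpε, hcΦ⟩ := hcase
      have h1 := hnearε hpε
      refine ⟨ℂ, inferInstance, inferInstance,
        fun ξ => φ (f ξ) ^ m * gaussMinorant κ (f ζ - p) (f ξ - p), ?_, ?_, ?_⟩
      · filter_upwards [h1] with ξ hξ
        exact ((hφf ξ hξ.1 hξ.2).pow m).mul
          ((differentiable_gaussMinorant κ _ _).comp ξ ((hdiff ξ hξ.1).sub_const p))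
      · filter_upwards [h1, hEΨ] with ξ hξ h2
        rw [h2, hΨin _ hξ.2, norm_mul, norm_pow, norm_gaussMinorant]
        refine le_max_of_le_left ?_
        simp only [hΦ]
        gcongr
        linarith [sq_nonneg ‖f ξ - p - (f ζ - p)‖]
      · dsimp only
        rw [hEΨ.self_of_nhds, hΨin _ hpε, max_eq_left hcΦ, norm_mul, norm_pow,
          norm_gaussMinorant]
        simp [hΦ]
    · refine ⟨ℂ, inferInstance, inferInstance, fun _ => (c : ℂ),
        Eventually.of_forall fun ξ => differentiableAt_const _,
        ?_, ?_⟩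
      · filter_upwards [hEΨ] with ξ h2
        rw [h2, Complex.norm_real, Real.norm_of_nonneg hc0.le]
        exact hΨc _
      · dsimp only
        rw [hEΨ.self_of_nhds, Complex.norm_real, Real.norm_of_nonneg hc0.le]
        by_cases hpε : dist (f ζ) p < ε
        · rw [hΨin _ hpε, max_eq_right]
          exact (not_le.1 fun h => hcase ⟨hpε, h⟩).le
        · exact (if_neg hpε).symm
  have hEM : ∀ ζ : ℂ, ‖ζ‖ = 1 / 2 → E (f ζ) ≤ M := by
    intro ζ hζ
    have h1 := hΨM _ (hfD ζ (by rw [hζ]; norm_num))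
    calc E (f ζ) ≤ 1 * Ψ (f ζ) := by
          simp only [hE]
          have := hc0.le.trans (hΨc (f ζ))
          gcongr
          exact poleFactor_le_one _
      _ ≤ M := by rwa [one_mul]
  have hnear0 : ∀ᶠ ξ in 𝓝 (0 : ℂ), ‖ξ‖ < 1 ∧ dist (f ξ) z < ρ :=
    (hnorm 0 (by simp)).and
      ((hdist 0 (by simp) z).eventually (gt_mem_nhds (by simpa [hz] using hρ)))
  -- The Schwarz lemma gives `E (f ζ) ≤ 2 M ‖ζ‖`.
  intro ζ hζ
  have hζr : ‖ζ‖ < c / (2 * M) := mem_ball_zero_iff.1 hζ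
  have hr2 : c / (2 * M) ≤ 1 / 2 := by
    rw [div_le_div_iff₀ (by positivity) (by norm_num)]; linarith
  have hschwarz := le_mul_norm_of_hasHolMinorantAt (by norm_num : (0 : ℝ) < 1 / 2) hEcont hmin hEM
    (h := fun ξ => H (f ξ))
    (hnear0.mono fun ξ hξ => hHdiff ξ hξ.1 (by linarith [htri _ hξ.2.le]))
    (by simp [hH, hz]) (hnear0.mono fun ξ hξ => (hHeq _ (hfD ξ hξ.1) hξ.2.le).symm)
    (mem_closedBall_zero_iff.2 (hζr.le.trans hr2))
  by_contra hfar
  -- Off the ball around `z` the function `E` is at least `c`.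
  have hzfar : ρ ≤ dist (f ζ) z := by
    by_contra h
    exact hfar (Metric.mem_ball.2 (by linarith [htri _ (not_le.1 h).le]))
  have hcE : c ≤ E (f ζ) := by
    simp only [hE]
    rw [poleFactor_of_ge ((one_le_div hρ).2 hzfar), one_mul]
    exact hΨc _
  have : M / (1 / 2) * ‖ζ‖ < c := by
    rw [lt_div_iff₀ (by positivity)] at hζr
    linarith
  linarith

/-! ### Localization of Kobayashi balls and of the Fridman invariant -/

lemma artanh_div_le {r t : ℝ} (hr : 0 < r) (hr1 : r ≤ 1) (ht : 0 ≤ t) (htr : t ≤ r / 2) :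
    Real.artanh (t / r) ≤ 4 / r * Real.artanh t := by
  have hx0 : 0 ≤ t / r := by positivity
  have hx1 : t / r ≤ 1 / 2 := by rw [div_le_iff₀ hr]; linarith
  have h1 : ∀ x : ℝ, 0 ≤ x → x ≤ 1 / 2 → Real.artanh x ≤ 2 * x := by
    intro x h0 h2
    rw [Real.artanh_eq_half_log ⟨by linarith, by linarith⟩]
    have h3 : Real.log ((1 + x) / (1 - x)) ≤ (1 + x) / (1 - x) - 1 :=
      Real.log_le_sub_one_of_pos (div_pos (by linarith) (by linarith))
    have h4 : (1 + x) / (1 - x) - 1 ≤ 4 * x := by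
      rw [div_sub_one (by linarith), div_le_iff₀ (by linarith)]
      nlinarith
    linarith
  have h2 : t ≤ 2 * Real.artanh t := by
    rw [Real.artanh_eq_half_log ⟨by linarith, by linarith⟩,
      Real.log_div (by linarith) (by linarith)]
    have h3 : Real.log (1 - t) ≤ 1 - t - 1 := Real.log_le_sub_one_of_pos (by linarith)
    have h4 : 0 ≤ Real.log (1 + t) := Real.log_nonneg (by linarith)
    linarith
  calc Real.artanh (t / r) ≤ 2 * (t / r) := h1 _ hx0 hx1
    _ = 2 / r * t := by ring
    _ ≤ 2 / r * (2 * Real.artanh t) := by gcongr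
    _ = _ := by ring

/-- **Localization of Kobayashi balls.** Near a peak point, Kobayashi balls of `D` are contained in
those of a small piece of `D`, with radius enlarged by a constant factor. -/
lemma kobayashiBall_localization {n : ℕ} {D V : Set (CSpace n)} {p : CSpace n} {φ : CSpace n → ℂ}
    {ε : ℝ} (hD : IsOpen D) (hV : IsOpen V) (hp : p ∈ closure D) (hpD : p ∉ D) (hε : 0 < ε)
    (hεV : Metric.closedBall p ε ⊆ V)
    (hφd : DifferentiableOn ℂ φ (D ∩ V)) (hφc : ContinuousOn φ (closure D ∩ V)) (hφp : φ p = 1)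
    (hφ1 : ∀ z ∈ closure D ∩ V, z ≠ p → ‖φ z‖ < 1) :
    ∃ C : ℝ, 0 < C ∧ ∀ R : ℝ, 0 < R → ∀ᶠ z in 𝓝[D] p,
      kobayashiBall D z R ⊆ kobayashiBall (D ∩ Metric.ball p ε) z (C * R) := by
  classical
  obtain ⟨δ, r, hδ, hr, hr1, hloc⟩ :=
    disc_localization hD hV hp hε hεV hφd hφc hφp hφ1
  obtain ⟨s, hs0, hs1, hs⟩ := exists_norm_le_of_peak hδ hεV hφc hφ1
  refine ⟨4 / r, by positivity, fun R hR => ?_⟩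
  set C := 4 / r
  have hC0 : 0 < C := by positivity
  set G := D ∩ Metric.ball p ε
  have hpV : p ∈ V := hεV (Metric.mem_closedBall_self hε.le)
  have hGV : G ⊆ D ∩ V := fun x hx => ⟨hx.1, hεV (Metric.ball_subset_closedBall hx.2)⟩
  have hne : ∀ x ∈ D, x ≠ p := fun x hx h => hpD (h ▸ hx)
  have hlt : ∀ x ∈ G, ‖φ x‖ < 1 := fun x hx =>
    hφ1 x ⟨subset_closure hx.1, (hGV hx).2⟩ (hne x hx.1)
  -- Here `z` is close to `p`: points of `G` away from `p` are then at distance at least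
  -- `C * R` from `z`.
  have hev : ∀ᶠ z in 𝓝[D] p, Real.tanh (Real.artanh s + C * R) < ‖φ z‖ :=
    eventually_lt_norm_of_peak hV hpV hp hφc hφp (Real.tanh_lt_one _)
  filter_upwards [hev, self_mem_nhdsWithin,
    nhdsWithin_le_nhds (Metric.ball_mem_nhds p hε)] with z hz hzD hzε
  have hzG : z ∈ G := ⟨hzD, hzε⟩
  have hsep : ∀ x ∈ G, δ ≤ dist x p → ENNReal.ofReal (C * R) ≤ kobayashi G z x := by
    intro x hx hxδ
    have hxs : ‖φ x‖ ≤ s := hs x hx.1 (Metric.mem_ball.1 hx.2).le hxδ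
    have key := ofReal_abs_sub_le_kobayashi (D := G) (ρ := fun x => Real.artanh ‖φ x‖) one_pos
      (fun f hf μ hμ => by
        rw [one_mul]
        refine artanh_norm_le_of_holMap (g := φ ∘ f) ⟨?_, ?_⟩ hμ
        · exact hφd.comp hf.1 (hf.2.mono_right hGV)
        · exact fun ζ hζ => mem_ball_zero_iff.2 (hlt _ (hf.2 hζ))) z x
    refine (ENNReal.ofReal_le_ofReal ?_).trans key
    rw [div_one]
    have h1 : Real.artanh ‖φ x‖ ≤ Real.artanh s :=
      Real.artanh_le_artanh (by linarith [norm_nonneg (φ x)]) hs1 hxs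
    have h2 : Real.artanh s + C * R ≤ Real.artanh ‖φ z‖ := by
      rw [← Real.artanh_tanh (Real.artanh s + C * R)]
      exact Real.artanh_le_artanh (Real.neg_one_lt_tanh _) (hlt z hzG) hz.le
    exact le_trans (by linarith) (le_abs_self _)
  obtain ⟨hps, hple⟩ := kobayashi_isPseudodistOn G
  -- The truncated distance to `z` in `G`, extended by a constant to `D`.
  set T := ENNReal.ofReal (C * R)
  have hTtop : T ≠ ⊤ := ENNReal.ofReal_ne_top
  set ρ : CSpace n → ℝ := fun x => if x ∈ G then (min (kobayashi G z x) T).toReal else T.toReal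
    with hρ
  have hρle : ∀ x, ρ x ≤ T.toReal := by
    intro x
    simp only [hρ]
    split_ifs
    · exact ENNReal.toReal_mono hTtop (min_le_right _ _)
    · exact le_rfl
  have hρfar : ∀ x, δ ≤ dist x p → ρ x = T.toReal := by
    intro x hx
    by_cases hxG : x ∈ G
    · simp only [hρ, if_pos hxG, min_eq_right (hsep x hxG hx)]
    · simp only [hρ, if_neg hxG]
  -- Short pieces of discs which start near `p` stay in `G`.
  have hshort : ∀ f : ℂ → CSpace n, HolMap (Metric.ball 0 1) D f → ∀ ν : ℂ, ‖ν‖ < r / 2 →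
      dist (f 0) p < δ → f 0 ∈ G ∧ f ν ∈ G ∧
        kobayashi G (f 0) (f ν) ≤ ENNReal.ofReal (C * Real.artanh ‖ν‖) := by
    intro f hf ν hν h0
    have hsub : Metric.ball (0 : ℂ) r ⊆ Metric.ball 0 1 := Metric.ball_subset_ball hr1
    have hfG : MapsTo f (Metric.ball 0 r) G := fun ζ hζ => ⟨hf.2 (hsub hζ), hloc f hf h0 hζ⟩
    have hνr : ν ∈ Metric.ball (0 : ℂ) r := mem_ball_zero_iff.2 (by linarith)
    have h0G := hfG (Metric.mem_ball_self hr)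
    refine ⟨h0G, hfG hνr, (hple _ h0G _ (hfG hνr)).trans (sInf_le_of_le
      ⟨fun ζ => f (r * ζ), ν / r, ⟨?_, ?_⟩, ?_, by simp, ?_, rfl⟩ ?_)⟩
    · refine (hf.1.mono hsub).comp (by fun_prop) fun ζ hζ => ?_
      rw [mem_ball_zero_iff] at hζ ⊢
      rw [norm_mul, Complex.norm_real, Real.norm_of_nonneg hr.le]
      nlinarith
    · refine hfG.comp fun ζ hζ => ?_
      rw [mem_ball_zero_iff] at hζ ⊢
      rw [norm_mul, Complex.norm_real, Real.norm_of_nonneg hr.le]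
      nlinarith
    · rw [norm_div, Complex.norm_real, Real.norm_of_nonneg hr.le, div_lt_one hr]
      linarith
    · have : (r : ℂ) ≠ 0 := by exact_mod_cast hr.ne'
      dsimp only
      rw [mul_div_cancel₀ _ this]
    · rw [norm_div, Complex.norm_real, Real.norm_of_nonneg hr.le]
      exact ENNReal.ofReal_le_ofReal (artanh_div_le hr hr1 (norm_nonneg _) hν.le)
  -- By the triangle inequality in `G`, `ρ` is Lipschitz there.
  have hlip : ∀ x ∈ G, ∀ y ∈ G, ∀ t : ℝ, 0 ≤ t → kobayashi G x y ≤ ENNReal.ofReal t →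
      ρ y ≤ ρ x + t := by
    intro x hx y hy t ht hxy
    simp only [hρ, if_pos hx, if_pos hy]
    have h1 : min (kobayashi G z y) T ≤ min (kobayashi G z x) T + ENNReal.ofReal t := by
      have := hps.triangle z hzG x hx y hy
      rw [← min_add_add_right]
      exact min_le_min (this.trans (by gcongr)) le_self_add
    have h2 : min (kobayashi G z x) T ≠ ⊤ := ne_top_of_le_ne_top hTtop (min_le_right _ _)
    calc (min (kobayashi G z y) T).toReal
        ≤ (min (kobayashi G z x) T + ENNReal.ofReal t).toReal :=
          ENNReal.toReal_mono (ENNReal.add_ne_top.2 ⟨h2, ENNReal.ofReal_ne_top⟩) h1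
      _ = _ := by rw [ENNReal.toReal_add h2 ENNReal.ofReal_ne_top, ENNReal.toReal_ofReal ht]
  have hsmall : ∀ f : ℂ → CSpace n, HolMap (Metric.ball 0 1) D f → ∀ ν : ℂ, ‖ν‖ < 1 →
      ‖ν‖ < r / 2 → ρ (f ν) ≤ ρ (f 0) + C * Real.artanh ‖ν‖ := by
    intro f hf ν hν1 hν
    have hpos : 0 ≤ C * Real.artanh ‖ν‖ :=
      mul_nonneg hC0.le (Real.artanh_nonneg (norm_nonneg ν))
    rcases lt_or_ge (dist (f 0) p) δ with h0 | h0
    · obtain ⟨h1, h2, h3⟩ := hshort f hf ν hν h0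
      exact hlip _ h1 _ h2 _ hpos h3
    · rw [hρfar _ h0]
      linarith [hρle (f ν)]
  intro w hw
  have hk := (ofReal_abs_sub_le_kobayashi hC0
    (fun f hf μ hμ => increment_le_of_small (by positivity) hsmall hf hμ) z w).trans_lt hw.2
  rw [ENNReal.ofReal_lt_ofReal_iff hR, div_lt_iff₀ hC0] at hk
  have hρz : ρ z = 0 := by simp [hρ, hzG, hps.self z hzG]
  have hTr : T.toReal = C * R := ENNReal.toReal_ofReal (by positivity)
  have hρw : ρ w < T.toReal := by
    rw [hTr, mul_comm C]
    rw [hρz, zero_sub, abs_neg] at hk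
    exact (le_abs_self _).trans_lt hk
  by_cases hwG : w ∈ G
  · refine ⟨hwG, lt_of_not_ge fun hge => ?_⟩
    simp only [hρ, if_pos hwG] at hρw
    rw [min_eq_right hge] at hρw
    exact lt_irrefl _ hρw
  · simp only [hρ, if_neg hwG] at hρw
    exact absurd hρw (lt_irrefl _)

lemma fridman_le_one {n : ℕ} (G : Set (CSpace n)) (z : CSpace n) : fridman G z ≤ 1 := by
  refine Real.sSup_le ?_ zero_le_one
  rintro t ⟨r, f, -, -, -, -, rfl⟩
  exact (Real.tanh_lt_one r).le

theorem proposition3 {n : ℕ} (D U : Set (CSpace n)) (p₀ : CSpace n)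
    (hDo : IsOpen D) (hDc : IsConnected D)
    (hp₀ : IsLocalHolPeakPoint D p₀)
    (hUo : IsOpen U) (hpU : p₀ ∈ U)
    (hlim : Tendsto (fridman (D ∩ U)) (𝓝[D ∩ U] p₀) (𝓝 1)) :
    Tendsto (fridman D) (𝓝[D] p₀) (𝓝 1) := by
  obtain ⟨hfr, V, φ, hVo, hpV, hφd, hφc, hφp, hφ1⟩ := hp₀
  have hpD : p₀ ∉ D := by
    rw [hDo.frontier_eq] at hfr
    exact hfr.2
  obtain ⟨ε, hε, hεUV⟩ := Metric.nhds_basis_closedBall.mem_iff.1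
    (inter_mem (hUo.mem_nhds hpU) (hVo.mem_nhds hpV))
  obtain ⟨C, hC, hball⟩ := kobayashiBall_localization hDo hVo (frontier_subset_closure hfr) hpD hε
    (hεUV.trans inter_subset_right) hφd hφc hφp hφ1
  have hnhds : 𝓝[D ∩ U] p₀ = 𝓝[D] p₀ :=
    nhdsWithin_inter_of_mem' (nhdsWithin_le_nhds (hUo.mem_nhds hpU))
  rw [hnhds] at hlim
  have hsub : D ∩ Metric.ball p₀ ε ⊆ D ∩ U :=
    inter_subset_inter_right _ (Metric.ball_subset_closedBall.trans (hεUV.trans inter_subset_left))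
  rw [tendsto_order]
  refine ⟨fun a ha => ?_, fun a ha => Eventually.of_forall fun z => (fridman_le_one D z).trans_lt ha⟩
  -- Choose `R` with `a < tanh R`.
  set b := max a (1 / 2) with hb
  have hb1 : b < 1 := max_lt ha (by norm_num)
  have hb0 : 0 < b := lt_of_lt_of_le (by norm_num) (le_max_right _ _)
  obtain ⟨c, hbc, hc1⟩ := exists_between hb1
  set R := Real.artanh c with hR
  have hR0 : 0 < R := Real.artanh_pos ⟨by linarith, hc1⟩
  have hRc : Real.tanh R = c := Real.tanh_artanh ⟨by linarith, hc1⟩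
  filter_upwards [hball R hR0,
    hlim.eventually (lt_mem_nhds (Real.tanh_lt_one (C * R)))] with z hz1 hz2
  have hCR : 0 < Real.tanh (C * R) := by
    simpa using tanh_strictMono (show (0 : ℝ) < C * R by positivity)
  -- The set defining `fridman` is not empty, since `sSup ∅ = 0`.
  have hne : {t | ∃ (r : ℝ) (f : CSpace n → CSpace n), 0 < r ∧
      HolMap (Metric.ball 0 1) (D ∩ U) f ∧ InjOn f (Metric.ball 0 1) ∧
      kobayashiBall (D ∩ U) z r ⊆ f '' Metric.ball 0 1 ∧ t = Real.tanh r}.Nonempty := by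
    by_contra hempty
    rw [not_nonempty_iff_eq_empty] at hempty
    rw [fridman, hempty, Real.sSup_empty] at hz2
    exact absurd hz2 (not_lt.2 hCR.le)
  obtain ⟨t, ⟨r, f, -, hf, hinj, hsubf, rfl⟩, ht⟩ := exists_lt_of_lt_csSup hne hz2
  have hr : C * R < r := tanh_strictMono.lt_iff_lt.1 ht
  have hle : c ≤ fridman D z := by
    rw [← hRc]
    refine le_csSup ⟨1, ?_⟩ ⟨R, f, hR0, ⟨hf.1, hf.2.mono_right inter_subset_left⟩, hinj, ?_, rfl⟩
    · rintro t ⟨r, f, -, -, -, -, rfl⟩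
      exact (Real.tanh_lt_one r).le
    · intro w hw
      obtain ⟨hwG, hwk⟩ := hz1 hw
      exact hsubf ⟨hsub hwG, (kobayashi_anti hsub z w).trans_lt
        (hwk.trans_le (ENNReal.ofReal_le_ofReal hr.le))⟩
  exact (le_max_left a (1 / 2)).trans_lt (hbc.trans_le hle)
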